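/- Let $X$ be a hemicompact Tychonoff space, i.e. there is a sequence $(K_n)_{n\in\mathbb{N}}$ of compact subsets of $X$ such that every compact subset of $X$ is contained in some $K_n$. Let $E$ be an AM-space, i.e. a real Banach lattice with $\|x\vee y\|=\max(\|x\|,\|y\|)$ for all $x,y\ge 0$ in $E$. Let $C(X,E)$ be the vector lattice of all continuous functions $X\to E$, with pointwise operations and order and with the compact-open topology. Let $F$ be a linear sublattice of $C(X,E)$, i.e. a linear subspace closed under binary suprema and infima, and suppose that $F$ contains every $E$-valued constant function. Suppose also that for every nonzero real-valued vector lattice homomorphism $\mu$ on $E$ (a linear functional preserving binary suprema and infima) the set $\{\mu\circ f : f\in F\}$ separates the points of $X$. Then $F$ is dense in $C(X,E)$. -/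

import Mathlib

/-- A space is hemicompact if there is a sequence of compact sets such that every compact set
is contained in one of them. -/
class HemicompactSpace (X : Type*) [TopologicalSpace X] : Prop where
  exists_compact_seq : ∃ K : ℕ → Set X, (∀ n, IsCompact (K n)) ∧
    ∀ C : Set X, IsCompact C → ∃ n, C ⊆ K n

/-- A Banach lattice is an AM-space if the norm of the supremum of two positive elements is the
maximum of their norms. The Banach lattice axioms are carried by the instance arguments. -/
class IsAMSpace (E : Type*) [NormedAddCommGroup E] [NormedSpace ℝ E] [CompleteSpace E]
    [Lattice E] [IsOrderedAddMonoid E] [IsOrderedModule ℝ E] [HasSolidNorm E] : Prop where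
  norm_sup : ∀ x y : E, 0 ≤ x → 0 ≤ y → ‖x ⊔ y‖ = max ‖x‖ ‖y‖

/-- A real linear functional on a vector lattice is a lattice homomorphism if it preserves
binary suprema and infima. -/
def IsLatticeHom {E : Type*} [AddCommGroup E] [Module ℝ E] [Lattice E] (μ : E →ₗ[ℝ] ℝ) : Prop :=
  (∀ x y : E, μ (x ⊔ y) = μ x ⊔ μ y) ∧ ∀ x y : E, μ (x ⊓ y) = μ x ⊓ μ y

/-- A linear subspace of a vector lattice is a (vector) sublattice if it is closed under
binary suprema and infima. -/
def IsVectorSublattice {V : Type*} [AddCommGroup V] [Module ℝ V] [Lattice V]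
    (F : Submodule ℝ V) : Prop :=
  (∀ f ∈ F, ∀ g ∈ F, f ⊔ g ∈ F) ∧ ∀ f ∈ F, ∀ g ∈ F, f ⊓ g ∈ F

/-! It suffices to approximate `f` uniformly on a compact `K`. The set `H` of contractive lattice
homomorphisms `E → ℝ` is compact for pointwise convergence, and because `E` is an AM-space it is
norming: some `m ∈ H` has `‖x‖ ≤ |m x|`. Hence `g ↦ ((x, m) ↦ m (g x))` is a lattice map into `C(K ×
H, ℝ)` carrying the sup norm over `K` to the sup norm. Kakutani–Stone then asks only for
interpolation at two points `(x, m)`, `(y, n)`: constants suffice unless `m`, `n` are proportional,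
and then separation applies. Norming homomorphisms come from Zorn's lemma: below `y ↦ ‖y ⊔ 0‖` lie
minimal sup-preserving sublinear maps, and minimality forces linearity. -/

open Set Filter Topology

/-- Maps `p : E → ℝ` that are sublinear, monotone, preserve binary suprema and are dominated by the
norm. The minimal ones among them are linear lattice homomorphisms. -/
structure IsSupSublinear {E : Type*} [NormedAddCommGroup E] [NormedSpace ℝ E] [Lattice E]
    (p : E → ℝ) : Prop where
  mono : Monotone p
  add_le : ∀ y z, p (y + z) ≤ p y + p z
  smul_le : ∀ t : ℝ, 0 < t → ∀ y, p (t • y) ≤ t * p y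
  sup_le : ∀ y z, p (y ⊔ z) ≤ p y ⊔ p z
  le_norm : ∀ y, p y ≤ ‖y‖

section SupSublinear

variable {E : Type*} [NormedAddCommGroup E] [NormedSpace ℝ E] [Lattice E]

namespace IsSupSublinear

variable {p : E → ℝ}

lemma map_zero (hp : IsSupSublinear p) : p 0 = 0 := by
  have h1 := hp.le_norm 0
  have h2 := hp.smul_le 2 two_pos 0
  rw [norm_zero] at h1
  rw [smul_zero] at h2
  linarith

lemma map_smul (hp : IsSupSublinear p) {t : ℝ} (ht : 0 ≤ t) (y : E) : p (t • y) = t * p y := by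
  rcases ht.eq_or_lt with rfl | ht
  · simp [hp.map_zero]
  refine le_antisymm (hp.smul_le t ht y) ?_
  have h := hp.smul_le t⁻¹ (inv_pos.2 ht) (t • y)
  rwa [inv_smul_smul₀ ht.ne', ← div_eq_inv_mul, le_div_iff₀ ht, mul_comm] at h

lemma neg_le (hp : IsSupSublinear p) (y : E) : -p (-y) ≤ p y := by
  have h := hp.add_le y (-y)
  rw [add_neg_cancel, hp.map_zero] at h
  linarith

/-- The pointwise infimum of a suitably directed family is again sublinear and sup-preserving. -/
lemma iInf {ι : Type*} [Nonempty ι] {p : ι → E → ℝ}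
    (bdd : ∀ z, BddBelow (range fun i => p i z))
    (mono : ∀ i, Monotone (p i))
    (add_le : ∀ i j y z, ∃ k, p k (y + z) ≤ p i y + p j z)
    (smul_le : ∀ i, ∀ t : ℝ, 0 < t → ∀ y, ∃ k, p k (t • y) ≤ t * p i y)
    (sup_le : ∀ i j y z, ∃ k, p k (y ⊔ z) ≤ p i y ⊔ p j z)
    (le_norm : ∀ y, ∃ i, p i y ≤ ‖y‖) :
    IsSupSublinear fun z => ⨅ i, p i z where
  mono y z hyz := ciInf_mono (bdd y) fun i => mono i hyz
  add_le y z := by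
    refine le_ciInf_add_ciInf fun i j => ?_
    obtain ⟨k, hk⟩ := add_le i j y z
    exact (ciInf_le (bdd _) k).trans hk
  smul_le t ht y := by
    rw [Real.mul_iInf_of_nonneg ht.le]
    refine le_ciInf fun i => ?_
    obtain ⟨k, hk⟩ := smul_le i t ht y
    exact (ciInf_le (bdd _) k).trans hk
  sup_le y z := by
    by_contra! h
    obtain ⟨hy, hz⟩ := sup_lt_iff.1 h
    obtain ⟨i, hi⟩ := exists_lt_of_ciInf_lt hy
    obtain ⟨j, hj⟩ := exists_lt_of_ciInf_lt hz
    obtain ⟨k, hk⟩ := sup_le i j y z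
    exact ((ciInf_le (bdd _) k).trans hk).not_gt (sup_lt_iff.2 ⟨hi, hj⟩)
  le_norm y := by
    obtain ⟨i, hi⟩ := le_norm y
    exact (ciInf_le (bdd _) i).trans hi

/-- Below any `p` and for any `y` there is a `q` whose value at `-y` is at most `-p y`. -/
lemma exists_le_map_neg_le [IsOrderedAddMonoid E] (hp : IsSupSublinear p) (y : E) :
    ∃ q, IsSupSublinear q ∧ q ≤ p ∧ q (-y) ≤ -p y := by
  -- The Hahn–Banach modification of `p` in direction `y`; `t = 0` gives `q ≤ p`, and `t = 1` gives
  -- the bound at `-y`.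
  let r : {t : ℝ // 0 ≤ t} → E → ℝ := fun t z => p (z + t.1 • y) - t.1 * p y
  have bdd : ∀ z, BddBelow (range fun i => r i z) := by
    refine fun z => ⟨-p (-z), ?_⟩
    rintro _ ⟨⟨t, ht⟩, rfl⟩
    have h := hp.add_le (z + t • y) (-z)
    rw [show z + t • y + -z = t • y by abel, hp.map_smul ht] at h
    simp only [r]
    linarith
  have : Nonempty {t : ℝ // 0 ≤ t} := ⟨⟨0, le_rfl⟩⟩
  -- Since `r` decreases in `t`, two indices can be replaced by their sum; a common shift commutes
  -- with `⊔`.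
  have key : ∀ z, ∀ i j : {t : ℝ // 0 ≤ t}, r (i + j) z ≤ r i z := by
    rintro z ⟨i, hi⟩ ⟨j, hj⟩
    have h := hp.add_le (z + i • y) (j • y)
    rw [hp.map_smul hj, add_assoc, ← add_smul] at h
    change p (z + (i + j) • y) - (i + j) * p y ≤ p (z + i • y) - i * p y
    linarith
  refine ⟨fun z => ⨅ i, r i z, iInf bdd ?_ ?_ ?_ ?_ ?_, fun z => ?_, ?_⟩
  · exact fun i z w hzw => sub_le_sub_right (hp.mono (by gcongr)) _
  · rintro ⟨i, hi⟩ ⟨j, hj⟩ z w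
    refine ⟨⟨i + j, add_nonneg hi hj⟩, ?_⟩
    have h := hp.add_le (z + i • y) (w + j • y)
    rw [show z + i • y + (w + j • y) = z + w + (i + j) • y by rw [add_smul]; abel] at h
    simp only [r]
    linarith
  · rintro ⟨i, hi⟩ t ht z
    refine ⟨⟨t * i, mul_nonneg ht.le hi⟩, ?_⟩
    have h := hp.smul_le t ht (z + i • y)
    rw [smul_add, smul_smul] at h
    simp only [r]
    linarith
  · intro i j z w
    refine ⟨i + j, ?_⟩
    have h : r (i + j) (z ⊔ w) ≤ r (i + j) z ⊔ r (i + j) w := by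
      simp only [r, sup_add, max_sub_sub_right]
      exact sub_le_sub_right (hp.sup_le _ _) _
    exact h.trans (sup_le_sup (key z i j) (add_comm i j ▸ key w j i))
  · exact fun z => ⟨⟨0, le_rfl⟩, by simpa [r] using hp.le_norm z⟩
  · exact (ciInf_le (bdd z) ⟨0, le_rfl⟩).trans_eq (by simp [r])
  · exact (ciInf_le (bdd _) ⟨1, zero_le_one⟩).trans_eq (by simp [r, hp.map_zero])

lemma exists_minimal_le (hp : IsSupSublinear p) :
    ∃ q ≤ p, Minimal IsSupSublinear q := by
  suffices h : _ by
    obtain ⟨m, hm, hmin⟩ := zorn_le_nonempty₀ (α := (E → ℝ)ᵒᵈ)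
      {q | IsSupSublinear (OrderDual.ofDual q)} h (OrderDual.toDual p) hp
    exact ⟨OrderDual.ofDual m, hm, hmin.1, fun q hq hqm =>
      hmin.2 (y := OrderDual.toDual q) hq hqm⟩
  intro c hc hchain y hy
  let r : c → E → ℝ := fun i => OrderDual.ofDual i.1
  have hr : ∀ i, IsSupSublinear (r i) := fun i => hc i.2
  have : Nonempty c := ⟨⟨y, hy⟩⟩
  have bdd : ∀ z, BddBelow (range fun i => r i z) := by
    refine fun z => ⟨-‖z‖, ?_⟩
    rintro _ ⟨i, rfl⟩
    have h := (hr i).le_norm (-z)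
    rw [norm_neg] at h
    linarith [(hr i).neg_le z]
  have dir : ∀ i j, ∃ k, r k ≤ r i ∧ r k ≤ r j := by
    intro i j
    rcases hchain.total i.2 j.2 with h | h
    · exact ⟨j, h, le_rfl⟩
    · exact ⟨i, le_rfl, h⟩
  refine ⟨OrderDual.toDual fun z => ⨅ i, r i z, iInf bdd (fun i => (hr i).mono) ?_ ?_ ?_ ?_, ?_⟩
  · intro i j z w
    obtain ⟨k, hi, hj⟩ := dir i j
    exact ⟨k, ((hr k).add_le z w).trans (add_le_add (hi z) (hj w))⟩
  · exact fun i t ht z => ⟨i, (hr i).smul_le t ht z⟩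
  · intro i j z w
    obtain ⟨k, hi, hj⟩ := dir i j
    exact ⟨k, ((hr k).sup_le z w).trans (sup_le_sup (hi z) (hj w))⟩
  · exact fun z => ⟨⟨y, hy⟩, (hr _).le_norm z⟩
  · exact fun q hq z => ciInf_le (bdd z) ⟨q, hq⟩

/-- Minimality gives `p ≤ q` for the modification `q` in direction `y`, hence `p (-y) ≤ -p y`. -/
lemma map_neg_of_minimal [IsOrderedAddMonoid E] (hp : Minimal IsSupSublinear p) (y : E) :
    p (-y) = -p y := by
  obtain ⟨q, hq, hqp, hy⟩ := hp.1.exists_le_map_neg_le y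
  refine le_antisymm ((hp.2 hq hqp (-y)).trans hy) ?_
  have := hp.1.neg_le y
  linarith

end IsSupSublinear

end SupSublinear

/-- The AM identity is exactly what makes this map respect suprema. -/
lemma isSupSublinear_norm_sup_zero {E : Type*} [NormedAddCommGroup E] [NormedSpace ℝ E]
    [CompleteSpace E] [Lattice E] [IsOrderedAddMonoid E] [IsOrderedModule ℝ E] [HasSolidNorm E]
    [IsAMSpace E] : IsSupSublinear fun y : E => ‖y ⊔ 0‖ := by
  have norm_mono : ∀ {y z : E}, 0 ≤ y → y ≤ z → ‖y‖ ≤ ‖z‖ := fun {y z} hy hyz =>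
    norm_le_norm_of_abs_le_abs (by rwa [abs_of_nonneg hy, abs_of_nonneg (hy.trans hyz)])
  refine ⟨fun y z hyz => norm_mono le_sup_right (sup_le_sup_right hyz _), fun y z => ?_,
    fun t ht y => ?_, fun y z => ?_, fun y => norm_le_norm_of_abs_le_abs ?_⟩
  · refine (norm_mono le_sup_right ?_).trans (norm_add_le _ _)
    exact sup_le (add_le_add le_sup_left le_sup_left) (add_nonneg le_sup_right le_sup_right)
  · calc ‖t • y ⊔ 0‖ ≤ ‖t • (y ⊔ 0)‖ := norm_mono le_sup_right
          (sup_le (smul_le_smul_of_nonneg_left le_sup_left ht.le)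
            (smul_nonneg ht.le le_sup_right))
      _ = t * ‖y ⊔ 0‖ := by rw [norm_smul, Real.norm_of_nonneg ht.le]
  · rw [← IsAMSpace.norm_sup _ _ le_sup_right le_sup_right, ← sup_sup_distrib_right]
  · rw [abs_of_nonneg le_sup_right]
    exact sup_le (le_abs_self y) (abs_nonneg y)

/-- The contractive lattice homomorphisms `E → ℝ`, as a subset of the product space `E → ℝ`. -/
def contractiveLatticeHoms (E : Type*) [NormedAddCommGroup E] [NormedSpace ℝ E] [Lattice E] :
    Set (E → ℝ) :=
  {m | (∀ x y, m (x + y) = m x + m y) ∧ (∀ (t : ℝ) x, m (t • x) = t * m x) ∧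
    (∀ x y, m (x ⊔ y) = m x ⊔ m y) ∧ ∀ x, |m x| ≤ ‖x‖}

section Homs

variable {E : Type*} [NormedAddCommGroup E] [NormedSpace ℝ E] [Lattice E]

lemma isCompact_contractiveLatticeHoms : IsCompact (contractiveLatticeHoms E) := by
  refine (isCompact_univ_pi fun x : E => isCompact_Icc (a := -‖x‖) (b := ‖x‖)).of_isClosed_subset
    ?_ fun m hm x _ => abs_le.1 (hm.2.2.2 x)
  simp only [contractiveLatticeHoms, ofPred_and, ofPred_forall]
  refine IsClosed.inter ?_ (IsClosed.inter ?_ (IsClosed.inter ?_ ?_))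
  · exact isClosed_iInter fun x => isClosed_iInter fun y =>
      isClosed_eq (by fun_prop) (by fun_prop)
  · exact isClosed_iInter fun t => isClosed_iInter fun x =>
      isClosed_eq (by fun_prop) (by fun_prop)
  · exact isClosed_iInter fun x => isClosed_iInter fun y =>
      isClosed_eq (by fun_prop) ((continuous_apply x).sup (continuous_apply y))
  · exact isClosed_iInter fun x => isClosed_le (by fun_prop) (by fun_prop)

lemma exists_isLatticeHom_of_mem_contractiveLatticeHoms [IsOrderedAddMonoid E] {m : E → ℝ}
    (hm : m ∈ contractiveLatticeHoms E) : ∃ μ : E →ₗ[ℝ] ℝ, IsLatticeHom μ ∧ ⇑μ = m := by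
  obtain ⟨hadd, hsmul, hsup, -⟩ := hm
  let μ : E →ₗ[ℝ] ℝ := { toFun := m, map_add' := hadd, map_smul' := hsmul }
  have hμ : ∀ x y, μ (x ⊔ y) = μ x ⊔ μ y := hsup
  refine ⟨μ, ⟨hμ, fun x y => ?_⟩, rfl⟩
  rw [← neg_neg (x ⊓ y), neg_inf, map_neg, hμ, map_neg, map_neg, neg_sup, neg_neg, neg_neg]

/-- All the homomorphisms are 1-Lipschitz, so separate continuity gives joint continuity. -/
lemma continuous_eval_contractiveLatticeHoms :
    Continuous fun q : contractiveLatticeHoms E × E => q.1.1 q.2 := by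
  refine continuous_prod_of_continuous_lipschitzWith' _ 1 (fun m => ?_)
    fun x => (continuous_apply x).comp continuous_subtype_val
  refine LipschitzWith.of_dist_le_mul fun x y => ?_
  obtain ⟨hadd, hsmul, -, hn⟩ := m.2
  have h : m.1 x - m.1 y = m.1 (x - y) := by
    have := hadd (x - y) y
    rw [sub_add_cancel] at this
    linarith
  rw [Real.dist_eq, h, NNReal.coe_one, one_mul, dist_eq_norm]
  exact hn _

lemma IsSupSublinear.mem_contractiveLatticeHoms_of_minimal [IsOrderedAddMonoid E] {p : E → ℝ}
    (hp : Minimal IsSupSublinear p) : p ∈ contractiveLatticeHoms E := by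
  have hneg := map_neg_of_minimal hp
  refine ⟨fun x y => (hp.1.add_le x y).antisymm ?_, fun t x => ?_, fun x y => ?_, fun x => ?_⟩
  · have h := hp.1.add_le (-x) (-y)
    rw [← neg_add, hneg, hneg, hneg] at h
    linarith
  · rcases le_total 0 t with ht | ht
    · exact hp.1.map_smul ht x
    · have h := hp.1.map_smul (neg_nonneg.2 ht) x
      rw [neg_smul, hneg] at h
      linarith
  · exact (hp.1.sup_le x y).antisymm
      (_root_.sup_le (hp.1.mono le_sup_left) (hp.1.mono le_sup_right))
  · have h := hp.1.le_norm (-x)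
    rw [hneg, norm_neg] at h
    exact abs_le.2 ⟨by linarith, hp.1.le_norm x⟩

lemma exists_contractiveLatticeHom_norm_le [CompleteSpace E] [IsOrderedAddMonoid E]
    [IsOrderedModule ℝ E] [HasSolidNorm E] [IsAMSpace E] (x : E) :
    ∃ m ∈ contractiveLatticeHoms E, ‖x‖ ≤ |m x| := by
  -- Working at `|x|` loses nothing: `‖|x| ⊔ 0‖ = ‖x‖` and `m |x| = |m x|`.
  obtain ⟨q, hq, -, hqx⟩ := (isSupSublinear_norm_sup_zero (E := E)).exists_le_map_neg_le |x|
  obtain ⟨m, hmq, hm⟩ := hq.exists_minimal_le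
  have hmem := IsSupSublinear.mem_contractiveLatticeHoms_of_minimal hm
  refine ⟨m, hmem, ?_⟩
  have hneg := IsSupSublinear.map_neg_of_minimal hm
  have h := (hmq (-|x|)).trans hqx
  rw [hneg, sup_eq_left.2 (abs_nonneg x), norm_abs_eq_norm] at h
  rw [abs, hmem.2.2.1, hneg] at h
  exact neg_le_neg_iff.1 h

end Homs

/-- **Kakutani–Stone**: on a compact space, a lattice of continuous functions approximates every
function that it interpolates at all pairs of points. -/
theorem ContinuousMap.mem_closure_of_forall_exists_interpolating {Z : Type*} [TopologicalSpace Z]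
    [CompactSpace Z] (L : Set C(Z, ℝ)) (nL : L.Nonempty)
    (inf_mem : ∀ᵉ (f ∈ L) (g ∈ L), f ⊓ g ∈ L) (sup_mem : ∀ᵉ (f ∈ L) (g ∈ L), f ⊔ g ∈ L)
    (f : C(Z, ℝ)) (hf : ∀ x y, ∃ g ∈ L, g x = f x ∧ g y = f y) : f ∈ closure L := by
  refine Metric.mem_closure_iff.2 fun ε pos => ?_
  rcases isEmpty_or_nonempty Z with hZ | hZ
  · obtain ⟨g, hg⟩ := nL
    exact ⟨g, hg, (ContinuousMap.dist_lt_iff pos).2 fun x => isEmptyElim x⟩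
  choose g hg w₁ w₂ using hf
  -- Finite suprema of interpolants through `x` keep the exact value there; finite infima of these
  -- then give the upper bound too.
  have above : ∀ x, ∃ h ∈ L, h x = f x ∧ ∀ z, f z - ε < h z := by
    intro x
    obtain ⟨s, hs⟩ := CompactSpace.elim_nhds_subcover (fun y => {z | f z - ε < g x y z})
      fun y => (isOpen_lt (by fun_prop) (by fun_prop)).mem_nhds
        (by rw [mem_ofPred_eq, w₂]; exact sub_lt_self _ pos)
    have ns : s.Nonempty := Set.nonempty_of_union_eq_top_of_nonempty _ _ hZ hs
    refine ⟨s.sup' ns (g x), Finset.sup'_mem _ sup_mem _ _ _ fun y _ => hg x y, ?_, fun z => ?_⟩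
    · simp [w₁]
    · obtain ⟨y, ym, zm⟩ := Set.exists_set_mem_of_union_eq_top _ _ hs z
      simp only [ContinuousMap.coe_sup', Finset.sup'_apply, Finset.lt_sup'_iff]
      exact ⟨y, ym, zm⟩
  choose h hL h_eq lt_h using above
  obtain ⟨s, hs⟩ := CompactSpace.elim_nhds_subcover (fun x => {z | h x z < f z + ε})
    fun x => (isOpen_lt (by fun_prop) (by fun_prop)).mem_nhds
      (by rw [mem_ofPred_eq, h_eq]; exact lt_add_of_pos_right _ pos)
  have ns : s.Nonempty := Set.nonempty_of_union_eq_top_of_nonempty _ _ hZ hs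
  refine ⟨s.inf' ns h, Finset.inf'_mem _ inf_mem _ _ _ fun x _ => hL x, ?_⟩
  refine (ContinuousMap.dist_lt_iff pos).2 fun z => ?_
  rw [dist_comm, Real.dist_eq, abs_sub_lt_iff, sub_lt_iff_lt_add', sub_lt_comm]
  obtain ⟨x, xm, zm⟩ := Set.exists_set_mem_of_union_eq_top _ _ hs z
  simp only [ContinuousMap.coe_inf', Finset.inf'_apply, Finset.inf'_lt_iff, Finset.lt_inf'_iff]
  exact ⟨⟨x, xm, zm⟩, fun x _ => lt_h x z⟩

/-- Two linear functionals on `V` can be interpolated simultaneously unless they are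
proportional. -/
lemma LinearMap.exists_eq_and_eq_or_exists_smul {V : Type*} [AddCommGroup V] [Module ℝ V]
    (φ ψ : V →ₗ[ℝ] ℝ) :
    (∀ a b : ℝ, ∃ v, φ v = a ∧ ψ v = b) ∨ (∃ c : ℝ, ψ = c • φ) ∨ φ = 0 := by
  by_cases hφ : φ = 0
  · exact Or.inr (Or.inr hφ)
  by_cases h : LinearMap.ker φ ≤ LinearMap.ker ψ
  · refine Or.inr (Or.inl ?_)
    obtain ⟨u, hu⟩ := DFunLike.ne_iff.1 hφ
    rw [LinearMap.zero_apply] at hu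
    refine ⟨ψ u / φ u, LinearMap.ext fun v => ?_⟩
    have : v - (φ v / φ u) • u ∈ LinearMap.ker ψ := h (by simp [hu])
    rw [LinearMap.mem_ker, map_sub, map_smul, sub_eq_zero] at this
    rw [this, LinearMap.smul_apply, smul_eq_mul, smul_eq_mul]
    ring
  · left
    obtain ⟨w, hw, hw'⟩ := SetLike.not_le_iff_exists.1 h
    obtain ⟨u, hu⟩ := DFunLike.ne_iff.1 hφ
    rw [LinearMap.mem_ker] at hw hw'
    rw [LinearMap.zero_apply] at hu
    intro a b
    refine ⟨(a / φ u) • u + ((b - a / φ u * ψ u) / ψ w) • w, ?_, ?_⟩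
    · simp [hw, hu]
    · simp [hw']

lemma exists_mem_apply_eq_and_apply_eq {X E : Type*} [TopologicalSpace X]
    [NormedAddCommGroup E] [NormedSpace ℝ E] [Lattice E]
    (F : Submodule ℝ C(X, E)) (hconst : ∀ e : E, ContinuousMap.const X e ∈ F)
    (hsep : ∀ μ : E →ₗ[ℝ] ℝ, IsLatticeHom μ → μ ≠ 0 →
      Set.SeparatesPoints {φ : X → ℝ | ∃ f ∈ F, φ = fun x => μ (f x)})
    {μ ν : E →ₗ[ℝ] ℝ} (hμ : IsLatticeHom μ) (f : C(X, E)) (x y : X) :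
    ∃ g ∈ F, μ (g x) = μ (f x) ∧ ν (g y) = ν (f y) := by
  rcases LinearMap.exists_eq_and_eq_or_exists_smul μ ν with h | ⟨c, rfl⟩ | rfl
  · obtain ⟨v, hv⟩ := h (μ (f x)) (ν (f y))
    exact ⟨_, hconst v, hv⟩
  · by_cases hμ0 : μ = 0
    · subst hμ0
      exact ⟨0, F.zero_mem, by simp⟩
    by_cases hxy : x = y
    · subst hxy
      exact ⟨_, hconst (f x), rfl, rfl⟩
    -- As `ν = c • μ`, it suffices to match `μ ∘ f` at both points: `s` scales the difference of
    -- values, and a constant corrects the level.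
    obtain ⟨_, ⟨g, hg, rfl⟩, hgxy⟩ := hsep μ hμ hμ0 hxy
    obtain ⟨u, hu⟩ := DFunLike.ne_iff.1 hμ0
    simp only [LinearMap.zero_apply] at hu hgxy
    have hd : μ (g x) - μ (g y) ≠ 0 := sub_ne_zero.2 hgxy
    set s := (μ (f x) - μ (f y)) / (μ (g x) - μ (g y)) with hs
    have hs' : s * (μ (g x) - μ (g y)) = μ (f x) - μ (f y) := div_mul_cancel₀ _ hd
    refine ⟨s • g + ContinuousMap.const X (((μ (f x) - s * μ (g x)) / μ u) • u),
      F.add_mem (F.smul_mem _ hg) (hconst _), ?_, ?_⟩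
    · simp [hu]
    · simp [hu]
      left
      linarith
  · exact ⟨_, hconst (f y), by simp⟩

theorem mainTheorem7 {X : Type*} [TopologicalSpace X] [T35Space X] [HemicompactSpace X]
    {E : Type*} [NormedAddCommGroup E] [NormedSpace ℝ E] [CompleteSpace E]
    [Lattice E] [IsOrderedAddMonoid E] [IsOrderedModule ℝ E] [HasSolidNorm E] [IsAMSpace E]
    (F : Submodule ℝ C(X, E)) (hF : IsVectorSublattice F)
    (hconst : ∀ e : E, ContinuousMap.const X e ∈ F)
    (hsep : ∀ μ : E →ₗ[ℝ] ℝ, IsLatticeHom μ → μ ≠ 0 →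
      Set.SeparatesPoints {φ : X → ℝ | ∃ f ∈ F, φ = fun x => μ (f x)}) :
    Dense (F : Set C(X, E)) := by
  intro f
  have hbasis := nhds_basis_uniformity' (x := f)
    (Metric.uniformity_basis_dist (α := E)).compactConvergenceUniformity
  refine (mem_closure_iff_nhds_basis hbasis).2 ?_
  rintro ⟨K, ε⟩ ⟨hK, hε⟩
  have : CompactSpace K := isCompact_iff_compactSpace.1 hK
  have : CompactSpace (contractiveLatticeHoms E) :=
    isCompact_iff_compactSpace.1 isCompact_contractiveLatticeHoms
  let Φ : C(X, E) → C(K × contractiveLatticeHoms E, ℝ) := fun g =>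
    ⟨fun q => q.2.1 (g q.1), continuous_eval_contractiveLatticeHoms.comp
      (continuous_snd.prodMk (g.continuous.comp (continuous_subtype_val.comp continuous_fst)))⟩
  have hcl : Φ f ∈ closure (Φ '' F) := by
    refine ContinuousMap.mem_closure_of_forall_exists_interpolating (Φ '' F)
      ⟨_, 0, F.zero_mem, rfl⟩ ?_ ?_ _ ?_
    · rintro _ ⟨g, hg, rfl⟩ _ ⟨h, hh, rfl⟩
      refine ⟨g ⊓ h, hF.2 g hg h hh, ContinuousMap.ext fun ⟨x, m⟩ => ?_⟩
      obtain ⟨μ, hμ, hm⟩ := exists_isLatticeHom_of_mem_contractiveLatticeHoms m.2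
      simpa [Φ, ← hm] using hμ.2 (g x) (h x)
    · rintro _ ⟨g, hg, rfl⟩ _ ⟨h, hh, rfl⟩
      exact ⟨g ⊔ h, hF.1 g hg h hh, ContinuousMap.ext fun ⟨x, m⟩ => m.2.2.2.1 (g x) (h x)⟩
    · rintro ⟨x, m⟩ ⟨y, n⟩
      obtain ⟨μ, hμ, hm⟩ := exists_isLatticeHom_of_mem_contractiveLatticeHoms m.2
      obtain ⟨ν, -, hn⟩ := exists_isLatticeHom_of_mem_contractiveLatticeHoms n.2
      obtain ⟨g, hg, h⟩ := exists_mem_apply_eq_and_apply_eq F hconst hsep (ν := ν) hμ f x y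
      exact ⟨Φ g, mem_image_of_mem _ hg, by simpa [Φ, ← hm, ← hn] using h⟩
  obtain ⟨_, ⟨g, hg, rfl⟩, hd⟩ := Metric.mem_closure_iff.1 hcl ε hε
  refine ⟨g, hg, fun x hx => ?_⟩
  -- A homomorphism norming `f x - g x` turns the scalar estimate back into one in `E`.
  obtain ⟨m, hm, hle⟩ := exists_contractiveLatticeHom_norm_le (f x - g x)
  obtain ⟨μ, -, rfl⟩ := exists_isLatticeHom_of_mem_contractiveLatticeHoms hm
  have h := (ContinuousMap.dist_lt_iff hε).1 hd (⟨x, hx⟩, ⟨μ, hm⟩)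
  rw [map_sub] at hle
  exact (dist_eq_norm (f x) (g x)).trans_le hle |>.trans_lt h
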